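/- **Kapranov's theorem.** Let $K$ be an algebraically closed field with a (Krull) valuation $v : K^\times \to \Gamma$ onto a linearly ordered abelian group $\Gamma$ (of arbitrary rank; the trivial valuation is allowed), and put $v(0)=\infty$. Let $F = \sum_{i \in I} c_i\, x_1^{i_1}\cdots x_n^{i_n}$ be a nonzero polynomial in $n$ variables over $K$, where $I \subseteq \mathbb{N}^n$ is finite and $c_i \neq 0$ for all $i \in I$. For $\gamma \in \Gamma^n$ put $F_v(\gamma) = \min_{i \in I}\bigl(v(c_i) + i_1\gamma_1 + \cdots + i_n\gamma_n\bigr)$, and call $\gamma$ a *tropical zero* of $F$ if this minimum is attained for at least two distinct $i \in I$. If $\gamma \in \Gamma^n$ is a tropical zero of $F$, then there is $a = (a_1,\dots,a_n) \in K^n$ with $F(a) = 0$ and $v(a_k) = \gamma_k$ for $k = 1,\dots,n$. -/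

import Mathlib

/-- The function `M_v : Γⁿ → Γ` induced by the monomial `M = c x₁^{i₁} ⋯ xₙ^{iₙ}`:
`M_v(γ) = v(c) + i₁γ₁ + ⋯ + iₙγₙ`, the value of `M` at any point of valuation `γ`.
It takes values in `Γ ∪ {∞}`, with value `∞` only for `c = 0`. -/
def monomialValue {K Γ : Type*} [Field K] [AddCommGroup Γ] [LinearOrder Γ] [IsOrderedAddMonoid Γ]
    (v : AddValuation K (WithTop Γ)) {n : ℕ} (i : Fin n →₀ ℕ) (c : K) (γ : Fin n → Γ) :
    WithTop Γ :=
  v c + ((∑ k, i k • γ k : Γ) : WithTop Γ)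

/-- The tropicalization `F_v(γ) = min_i M_{i,v}(γ)`, the minimum being over the monomials
occurring in `F` (and `∞` for `F = 0`). -/
noncomputable def tropicalization {K Γ : Type*} [Field K] [AddCommGroup Γ] [LinearOrder Γ]
    [IsOrderedAddMonoid Γ] (v : AddValuation K (WithTop Γ)) {n : ℕ}
    (F : MvPolynomial (Fin n) K) (γ : Fin n → Γ) : WithTop Γ :=
  F.support.inf fun i => monomialValue v i (F.coeff i) γ

/-- `γ` is a tropical zero of `F`: the minimum `F_v(γ)` is attained by two distinct monomials
of `F`. -/
def IsTropicalZero {K Γ : Type*} [Field K] [AddCommGroup Γ] [LinearOrder Γ]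
    [IsOrderedAddMonoid Γ] (v : AddValuation K (WithTop Γ)) {n : ℕ}
    (F : MvPolynomial (Fin n) K) (γ : Fin n → Γ) : Prop :=
  ∃ i ∈ F.support, ∃ j ∈ F.support, i ≠ j ∧
    monomialValue v i (F.coeff i) γ = tropicalization v F γ ∧
    monomialValue v j (F.coeff j) γ = tropicalization v F γ

/-!
The theorem reduces to one variable by a Kronecker substitution. Choose `t k` with
`v (t k) = γ k` and `N` larger than every exponent occurring in `F`. Substituting
`x k = t k * X ^ (N ^ k)` sends distinct monomials of `F` to distinct powers of `X`
(`sum_mul_pow_injOn`), so the resulting univariate polynomial has as its coefficients the numbers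
`c i * ∏ k, t k ^ i k`, whose values are the `monomialValue`s. The tropical zero hypothesis says
that the least value of a coefficient is attained twice, and a root `s` with `v s = 0` gives the
point `a k = t k * s ^ (N ^ k)`.

In one variable (`exists_root_value_zero`), multiplying a polynomial by `X - r` with `v r ≠ 0`
preserves the property that exactly one coefficient has least value: that coefficient moves one
step up if `v r > 0`, and stays in place, multiplied by `-r`, if `v r < 0`
(`HasUniqueMinCoeff.X_sub_C_mul`). Since the polynomial is a constant times a product of such
linear factors, a polynomial none of whose roots has value `0` has a unique coefficient of least
value.
-/

open Polynomial in
/-- Exactly one coefficient of `p` has least value. The condition ranges over all of `ℕ`, so that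
coefficient is nonzero and `p ≠ 0`. -/
def HasUniqueMinCoeff {K Γ : Type*} [Field K] [AddCommGroup Γ] [LinearOrder Γ]
    [IsOrderedAddMonoid Γ] (v : AddValuation K (WithTop Γ)) (p : K[X]) : Prop :=
  ∃ m, ∀ i, i ≠ m → v (p.coeff m) < v (p.coeff i)

section Univariate

open Polynomial

variable {K Γ : Type*} [Field K] [AddCommGroup Γ] [LinearOrder Γ] [IsOrderedAddMonoid Γ]
  {v : AddValuation K (WithTop Γ)}

theorem hasUniqueMinCoeff_C {a : K} (ha : a ≠ 0) : HasUniqueMinCoeff v (C a) := by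
  refine ⟨0, fun i hi => ?_⟩
  rw [coeff_C_zero, coeff_C_of_ne_zero hi, v.map_zero]
  exact lt_top_iff_ne_top.2 (v.ne_top_iff.2 ha)

/-- Multiplication by `X - r` moves the unique coefficient of least value one step up if
`v r > 0` (including `r = 0`), and keeps it in place if `v r < 0`. -/
theorem HasUniqueMinCoeff.X_sub_C_mul {p : K[X]} (hp : HasUniqueMinCoeff v p) {r : K}
    (hr : v r ≠ 0) : HasUniqueMinCoeff v ((X - C r) * p) := by
  obtain ⟨m, hm⟩ := hp
  have hle : ∀ i, v (p.coeff m) ≤ v (p.coeff i) := fun i => by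
    rcases eq_or_ne i m with rfl | h
    · exact le_rfl
    · exact (hm i h).le
  -- The index `m + 1` serves only as some index other than `m`.
  have htop : v (p.coeff m) ≠ ⊤ := (hm (m + 1) (by omega)).ne_top
  have hcoeff_zero : ((X - C r) * p).coeff 0 = -(r * p.coeff 0) := by
    simp [sub_mul]
  have hcoeff_succ : ∀ i, ((X - C r) * p).coeff (i + 1) = p.coeff i - r * p.coeff (i + 1) :=
    fun i => by simp [sub_mul, coeff_X_mul]
  rcases lt_or_gt_of_ne hr with hr | hr
  · have hlt : v r + v (p.coeff m) < v (p.coeff m) := by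
      simpa using WithTop.add_lt_add_right htop hr
    have hval : v (((X - C r) * p).coeff m) = v r + v (p.coeff m) := by
      cases m with
      | zero => rw [hcoeff_zero, v.map_neg, v.map_mul]
      | succ m =>
        rw [hcoeff_succ, v.map_sub_swap, ← v.map_mul]
        apply v.map_sub_eq_of_lt_left
        rw [v.map_mul]
        exact hlt.trans_le (hle m)
    refine ⟨m, fun i hi => ?_⟩
    have hmul : v r + v (p.coeff m) < v (r * p.coeff i) := by
      rw [v.map_mul]
      exact WithTop.add_lt_add_left hr.ne_top (hm i hi)
    rw [hval]
    cases i with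
    | zero => rwa [hcoeff_zero, v.map_neg]
    | succ i =>
      rw [hcoeff_succ]
      exact (lt_min (hlt.trans_le (hle i)) hmul).trans_le (v.map_sub _ _)
  · have hlt : ∀ i, v (p.coeff m) < v (r * p.coeff i) := fun i => by
      rw [v.map_mul]
      calc v (p.coeff m) < v r + v (p.coeff m) := by
            simpa using WithTop.add_lt_add_right htop hr
        _ ≤ v r + v (p.coeff i) := by gcongr; exact hle i
    refine ⟨m + 1, fun i hi => ?_⟩
    have hval : v (((X - C r) * p).coeff (m + 1)) = v (p.coeff m) := by
      rw [hcoeff_succ, v.map_sub_eq_of_lt_left (hlt _)]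
    rw [hval]
    cases i with
    | zero => rw [hcoeff_zero, v.map_neg]; exact hlt 0
    | succ i =>
      rw [hcoeff_succ]
      exact (lt_min (hm i (by omega)) (hlt _)).trans_le (v.map_sub _ _)

/-- The one-variable case: over an algebraically closed field, a nonzero polynomial whose least
coefficient value is attained at two places has a root of value `0`. -/
theorem exists_root_value_zero [IsAlgClosed K] {p : K[X]} (hp : p ≠ 0) {j l : ℕ} (hjl : j ≠ l)
    (hj : ∀ i, v (p.coeff j) ≤ v (p.coeff i)) (hl : ∀ i, v (p.coeff l) ≤ v (p.coeff i)) :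
    ∃ s, v s = 0 ∧ p.eval s = 0 := by
  by_contra! h
  have hprod : ∀ S : Multiset K, (∀ r ∈ S, v r ≠ 0) →
      HasUniqueMinCoeff v ((S.map fun r => X - C r).prod * C p.leadingCoeff) := by
    intro S
    induction S using Multiset.induction with
    | empty =>
      intro _
      simpa using hasUniqueMinCoeff_C (leadingCoeff_ne_zero.2 hp)
    | cons r S ih =>
      intro hS
      rw [Multiset.map_cons, Multiset.prod_cons, mul_assoc]
      exact (ih fun x hx => hS x (Multiset.mem_cons_of_mem hx)).X_sub_C_mul
        (hS r (Multiset.mem_cons_self r S))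
  obtain ⟨m, hm⟩ := hprod p.roots fun r hr hvr => h r hvr (mem_roots'.1 hr).2
  rw [mul_comm, ← (IsAlgClosed.splits p).eq_prod_roots] at hm
  rcases eq_or_ne j m with rfl | hjm
  · exact (hm l hjl.symm).not_ge (hl j)
  · exact (hm j hjm).not_ge (hj m)

end Univariate

/-- Uniqueness of base `N` expansions with `n` digits. -/
theorem sum_mul_pow_injOn (n N : ℕ) :
    Set.InjOn (fun i : Fin n →₀ ℕ => ∑ k, i k * N ^ (k : ℕ)) {i | ∀ k, i k < N} := by
  intro i hi j hj hij
  have h : (fun k => (⟨i k, hi k⟩ : Fin N)) = fun k => ⟨j k, hj k⟩ := by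
    apply finFunctionFinEquiv.injective
    apply Fin.ext
    simpa [finFunctionFinEquiv_apply] using hij
  ext k
  simpa using congrFun h k

theorem mainTheorem11 {K Γ : Type*} [Field K] [IsAlgClosed K]
    [AddCommGroup Γ] [LinearOrder Γ] [IsOrderedAddMonoid Γ]
    (v : AddValuation K (WithTop Γ)) (hv : Function.Surjective v)
    {n : ℕ} (F : MvPolynomial (Fin n) K) (hF : F ≠ 0)
    (γ : Fin n → Γ) (hγ : IsTropicalZero v F γ) :
    ∃ a : Fin n → K, (∀ k, v (a k) = (γ k : WithTop Γ)) ∧ MvPolynomial.eval a F = 0 := by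
  choose t ht using fun k => hv (γ k : WithTop Γ)
  obtain ⟨i, hi, j, hj, hij, hi_min, hj_min⟩ := hγ
  set N := F.totalDegree + 1 with hN
  set e : (Fin n →₀ ℕ) → ℕ := fun i => ∑ k, i k * N ^ (k : ℕ) with he
  have he_inj : Set.InjOn e F.support := (sum_mul_pow_injOn n N).mono fun i hi k =>
    Nat.lt_succ_of_le <| (MvPolynomial.monomial_le_degreeOf k hi).trans
      (MvPolynomial.degreeOf_le_totalDegree F k)
  set b : (Fin n →₀ ℕ) → K := fun i => F.coeff i * ∏ k, t k ^ i k with hb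
  have hvb : ∀ i, v (b i) = monomialValue v i (F.coeff i) γ := fun i => by
    have hprod : ∀ S : Finset (Fin n),
        v (∏ k ∈ S, t k ^ i k) = ((∑ k ∈ S, i k • γ k : Γ) : WithTop Γ) := fun S => by
      induction S using Finset.induction with
      | empty => simp
      | insert k S hk ih =>
        rw [Finset.prod_insert hk, Finset.sum_insert hk, v.map_mul, v.map_pow, ih, ht,
          WithTop.coe_add, WithTop.coe_nsmul]
    rw [hb, v.map_mul, hprod]; rfl
  -- `p` is the result of substituting `t k * X ^ (N ^ k)` for the `k`-th variable of `F`.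
  set p : Polynomial K := ∑ i ∈ F.support, Polynomial.monomial (e i) (b i) with hp
  have hcoeff : ∀ i ∈ F.support, p.coeff (e i) = b i := fun i hi => by
    rw [hp, Polynomial.finsetSum_coeff, Finset.sum_eq_single_of_mem i hi]
    · simp
    · intro l hl hli
      exact Polynomial.coeff_monomial_of_ne _ fun h => hli (he_inj hl hi h.symm)
  have hle : ∀ d, tropicalization v F γ ≤ v (p.coeff d) := fun d => by
    rw [hp, Polynomial.finsetSum_coeff]
    refine v.map_le_sum fun l hl => ?_
    rw [Polynomial.coeff_monomial]
    split_ifs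
    · rw [hvb]; exact Finset.inf_le hl
    · simp
  have hp0 : p ≠ 0 := fun h => by
    have hbi : b i = 0 := by rw [← hcoeff i hi, h, Polynomial.coeff_zero]
    have ht0 : ∀ k, t k ≠ 0 := fun k => v.ne_top_iff.1 (by rw [ht]; exact WithTop.coe_ne_top)
    exact mul_ne_zero (MvPolynomial.mem_support_iff.1 hi)
      (Finset.prod_ne_zero_iff.2 fun k _ => pow_ne_zero _ (ht0 k)) hbi
  obtain ⟨s, hs, hps⟩ := exists_root_value_zero (v := v) hp0
    (fun h => hij (he_inj hi hj h) : e i ≠ e j)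
    (fun d => by rw [hcoeff i hi, hvb, hi_min]; exact hle d)
    (fun d => by rw [hcoeff j hj, hvb, hj_min]; exact hle d)
  refine ⟨fun k => t k * s ^ (N ^ (k : ℕ)), fun k => ?_, ?_⟩
  · rw [v.map_mul, v.map_pow, hs, ht, smul_zero, add_zero]
  · rw [← hps, hp, Polynomial.eval_finsetSum, MvPolynomial.eval_eq']
    refine Finset.sum_congr rfl fun l _ => ?_
    rw [Polynomial.eval_monomial, hb, he]
    simp only [mul_pow, Finset.prod_mul_distrib, ← pow_mul, Finset.prod_pow_eq_pow_sum, mul_assoc,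
      mul_comm (N ^ _)]
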